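/- Let $N\ge 1$, let $\Omega\subset\mathbb{R}^N$ be a nonempty bounded open set (for instance a smooth bounded domain), let $\sigma\in(0,1)$ and $p\in(2,\infty)$. Put $$C(\sigma)=\Big(\int_{\mathbb{R}^N}\frac{1-\cos\zeta_1}{|\zeta|^{N+2\sigma}}\,d\zeta\Big)^{-1},\qquad \beta(t)=|t|^{p-1}\operatorname{sign}t .$$ Let $\mathcal X_{\sigma,0}$ be the space of all (real) $v\in L^2(\mathbb{R}^N)$ with $v=0$ a.e. in $\mathbb{R}^N\setminus\Omega$ and $\iint_{\mathbb{R}^{2N}}\frac{|v(x)-v(y)|^2}{|x-y|^{N+2\sigma}}\,dx\,dy<\infty$, let $\mathcal E_\sigma=\mathcal X_{\sigma,0}\cap L^p(\mathbb{R}^N)$, and for $v,\varphi\in\mathcal X_{\sigma,0}$ set $$\langle\mathfrak A_\sigma v,\varphi\rangle=\frac{C(\sigma)}2\iint_{\mathbb{R}^{2N}}\frac{(v(x)-v(y))(\varphi(x)-\varphi(y))}{|x-y|^{N+2\sigma}}\,dx\,dy .$$ Let $\lambda_1(\sigma)$ be the first (smallest) eigenvalue of the fractional Dirichlet Laplacian,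 that is, the smallest $\lambda\in\mathbb{R}$ for which there is $v\in\mathcal X_{\sigma,0}\setminus\{0\}$ with $\langle\mathfrak A_\sigma v,\varphi\rangle=\lambda\int_{\mathbb{R}^N}v\varphi\,dx$ for all $\varphi\in\mathcal X_{\sigma,0}$. Define the energy $$\mathbb E_\sigma(v)=\frac{C(\sigma)}4\iint_{\mathbb{R}^{2N}}\frac{|v(x)-v(y)|^2}{|x-y|^{N+2\sigma}}\,dx\,dy+\frac1p\int_\Omega|v|^p\,dx-\frac12\int_\Omega|v|^2\,dx,\qquad v\in\mathcal E_\sigma .$$ Suppose $\lambda_1(\sigma)<1$. Then $\inf_{\mathcal E_\sigma}\mathbb E_\sigma<0$, and there is a function $u\in\mathcal E_\sigma$, not a.e. equal to $0$, that is a global minimizer of $\mathbb E_\sigma$ over $\mathcal E_\sigma$ and a weak solution of the stationary problem $$(-\Delta)^\sigma u+\beta(u)-u=0\ \text{ in }\Omega,\qquad u=0\ \text{ in }\mathbb{R}^N\setminus\Omega,$$ that is, $$\langle\mathfrak A_\sigma u,\varphi\rangle+\int_\Omega\beta(u)\varphi\,dx-\int_\Omega u\,\varphi\,dx=0\qquad\text{for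 all }\varphi\in\mathcal E_\sigma .$$ -/

import Mathlib

open MeasureTheory Set

noncomputable section

namespace FracDirichlet

/-- The space `ℝ^N` with its Euclidean norm. -/
abbrev RN (N : ℕ) : Type := EuclideanSpace ℝ (Fin N)

variable {N : ℕ}

/-- The normalizing constant
`C(r) = (∫_{ℝ^N} (1 - cos ζ₁) / |ζ|^{N+2r} dζ)⁻¹` of the fractional Laplacian. -/
def normConst (N : ℕ) [NeZero N] (r : ℝ) : ℝ :=
  (∫ ζ : RN N, (1 - Real.cos (ζ 0)) / ‖ζ‖ ^ ((N : ℝ) + 2 * r))⁻¹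

/-- The singular kernel `K_r(z) = |z|^{-N-2r}`. -/
def kernel (r : ℝ) (z : RN N) : ℝ := ‖z‖ ^ (-(N : ℝ) - 2 * r)

/-- Square-integrable functions on `ℝ^N` that vanish a.e. outside `Ω`. -/
def L2Zero (Ω : Set (RN N)) : Set (RN N → ℝ) :=
  {v | MemLp v 2 volume ∧ ∀ᵐ x, x ∉ Ω → v x = 0}

/-- `Q = ℝ^{2N} \ ((ℝ^N \ Ω) × (ℝ^N \ Ω))`. -/
def interactionSet (Ω : Set (RN N)) : Set (RN N × RN N) := (Ωᶜ ×ˢ Ωᶜ)ᶜ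

/-- The fractional Sobolev space `𝒳_{r,0}`: those `v ∈ L²(ℝ^N)` vanishing a.e. outside `Ω` for
which `(x, y) ↦ (v(x) - v(y)) √K_r(x - y)` is square-integrable on `Q`. -/
def fracSobolevZero (Ω : Set (RN N)) (r : ℝ) : Set (RN N → ℝ) :=
  {v | v ∈ L2Zero Ω ∧
    MemLp (fun z : RN N × RN N => (v z.1 - v z.2) * √(kernel r (z.1 - z.2))) 2
      (volume.restrict (interactionSet Ω))}

/-- The weak fractional Laplacian as a bilinear form,
`⟨𝔄_r v, φ⟩ = C(r)/2 ∬_{ℝ^{2N}} K_r(x-y) (v(x)-v(y)) (φ(x)-φ(y)) dx dy`. -/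
def fracForm [NeZero N] (r : ℝ) (v φ : RN N → ℝ) : ℝ :=
  normConst N r / 2 *
    ∫ z : RN N × RN N, kernel r (z.1 - z.2) * (v z.1 - v z.2) * (φ z.1 - φ z.2)

/-- `lam` is an eigenvalue of `𝔄_r v = lam v`, `v ∈ 𝒳_{r,0}`, with the equation read in duality
with `𝒳_{r,0}`. -/
def IsFracEigenvalue [NeZero N] (Ω : Set (RN N)) (r lam : ℝ) : Prop :=
  ∃ v ∈ fracSobolevZero Ω r, ¬ (v =ᵐ[volume] 0) ∧
    ∀ φ ∈ fracSobolevZero Ω r, fracForm r v φ = lam * ∫ x, v x * φ x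

/-- The first (smallest) eigenvalue `λ₁(r)`. -/
def firstEigenvalue [NeZero N] (Ω : Set (RN N)) (r : ℝ) : ℝ :=
  sInf {lam : ℝ | IsFracEigenvalue Ω r lam}

/-- `β̂(t) = |t|^p / p`. -/
def betaHat (p t : ℝ) : ℝ := 1 / p * |t| ^ p

/-- `β(t) = |t|^{p-1} sign t`. -/
def beta (p t : ℝ) : ℝ := |t| ^ (p - 1) * Real.sign t

/-- The energy space `ℰ_σ = 𝒳_{σ,0} ∩ L^p(ℝ^N)`. -/
def energySpace (Ω : Set (RN N)) (σ p : ℝ) : Set (RN N → ℝ) :=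
  {v | v ∈ fracSobolevZero Ω σ ∧ MemLp v (ENNReal.ofReal p) volume}

/-- The energy
`𝔼_σ(v) = C(σ)/4 ∬ |v(x)-v(y)|² / |x-y|^{N+2σ} dx dy + ∫_Ω β̂(v) dx - 1/2 ∫_Ω |v|² dx`. -/
def energy [NeZero N] (Ω : Set (RN N)) (σ p : ℝ) (v : RN N → ℝ) : ℝ :=
  normConst N σ / 4 *
      (∫ z : RN N × RN N, |v z.1 - v z.2| ^ 2 / ‖z.1 - z.2‖ ^ ((N : ℝ) + 2 * σ))
    + (∫ x in Ω, betaHat p (v x)) - 1 / 2 * ∫ x in Ω, |v x| ^ 2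

/-- Weak solutions of `(-Δ)^σ u + β(u) - u = 0` in `Ω`, `u = 0` in `ℝ^N \ Ω`. -/
def IsWeakSolution [NeZero N] (Ω : Set (RN N)) (σ p : ℝ) (u : RN N → ℝ) : Prop :=
  u ∈ energySpace Ω σ p ∧
    ∀ φ ∈ energySpace Ω σ p,
      fracForm σ u φ + (∫ x in Ω, beta p (u x) * φ x) - (∫ x in Ω, u x * φ x) = 0

end FracDirichlet

end

open FracDirichlet

noncomputable section

namespace FracDirichlet

open Filter Topology

variable {N : ℕ}

/-! ### Integrability of the kernel -/

/-! The proof is the direct method. Since `p > 2`, `betaHat p t` dominates `t ^ 2` up to a constant,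
so on a bounded `Ω` the energy controls the Gagliardo seminorm and the `L²` norm
(`exists_energy_ge`). A minimizing sequence then has a subsequence converging a.e. and in `L²`
(`exists_subseq_tendsto`). Along it the negative term `-1/2 ∫ v²` converges, and the other two terms
are lower semicontinuous by Fatou, so the limit is a minimizer (`exists_isMinOn_energy`).
Differentiating the energy along lines gives the equation (`isWeakSolution_of_isMinOn`).

Compactness rests on a Poincaré inequality on cubes of side `h`: up to an `L²` error of order `h ^
r` times the seminorm, a function is determined by its finitely many cube integrals
(`totallyBounded_sobolevBall`).

The minimizer is nontrivial because the infimum is negative. An eigenfunction with eigenvalue below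
1, truncated so as to lie in `L^p`, makes the quadratic part of the energy negative, and for small
multiples the `p`-th power term is negligible (`exists_mem_energySpace_gagliardo_lt`,
`exists_energy_neg`). -/

lemma kernel_nonneg (r : ℝ) (z : RN N) : 0 ≤ kernel r z :=
  Real.rpow_nonneg (norm_nonneg _) _

lemma measurable_kernel (r : ℝ) : Measurable (kernel (N := N) r) := by
  unfold kernel
  fun_prop

lemma kernel_neg (r : ℝ) (z : RN N) : kernel r (-z) = kernel r z := by
  simp [kernel]

lemma div_norm_rpow_eq_mul_kernel (r a : ℝ) (z : RN N) :
    a / ‖z‖ ^ ((N : ℝ) + 2 * r) = a * kernel r z := by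
  rw [kernel, div_eq_mul_inv, ← Real.rpow_neg (norm_nonneg _)]
  congr 2
  ring

/-- The integrable majorant `min(1, |z|²) K_r(z)` of the kernel. -/
def truncatedKernel (r : ℝ) (z : RN N) : ℝ := min 1 (‖z‖ ^ 2) * kernel r z

lemma truncatedKernel_nonneg (r : ℝ) (z : RN N) : 0 ≤ truncatedKernel r z :=
  mul_nonneg (le_min zero_le_one (sq_nonneg _)) (kernel_nonneg r z)

/-- In polar coordinates the radial density is `y ^ (1 - 2 * r)` near 0, integrable since `r < 1`,
and `y ^ (-1 - 2 * r)` at infinity, integrable since `r > 0`. -/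
lemma integrable_truncatedKernel [NeZero N] {r : ℝ} (hr0 : 0 < r) (hr1 : r < 1) :
    Integrable (truncatedKernel (N := N) r) := by
  have hN : 1 ≤ N := Nat.one_le_iff_ne_zero.mpr (NeZero.ne N)
  have hcast : ((N - 1 : ℕ) : ℝ) = (N : ℝ) - 1 := by push_cast [hN]; ring
  have key := integrable_fun_norm_addHaar (E := RN N) volume
    (f := fun y : ℝ => min 1 (y ^ 2) * y ^ (-(N : ℝ) - 2 * r))
  refine key.mpr ?_
  rw [finrank_euclideanSpace_fin, ← Ioc_union_Ioi_eq_Ioi (zero_le_one' ℝ)]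
  refine IntegrableOn.union ?_ ?_
  · have h1 : IntegrableOn (fun y : ℝ => y ^ (1 - 2 * r)) (Ioc 0 1) := by
      rw [← intervalIntegrable_iff_integrableOn_Ioc_of_le zero_le_one]
      exact intervalIntegral.intervalIntegrable_rpow' (by linarith)
    refine h1.congr_fun (fun y hy => ?_) measurableSet_Ioc
    have hy0 : 0 < y := hy.1
    have : min 1 (y ^ 2) = y ^ 2 := min_eq_right (by nlinarith [hy.1, hy.2])
    simp only [smul_eq_mul, this]
    rw [← Real.rpow_natCast y (N - 1), ← Real.rpow_natCast y 2, ← Real.rpow_add hy0,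
      ← Real.rpow_add hy0, hcast]
    congr 1
    push_cast
    ring
  · have h1 : IntegrableOn (fun y : ℝ => y ^ (-1 - 2 * r)) (Ioi 1) :=
      integrableOn_Ioi_rpow_of_lt (by linarith) one_pos
    refine h1.congr_fun (fun y hy => ?_) measurableSet_Ioi
    have hy1 : 1 < y := hy
    have hy0 : 0 < y := one_pos.trans hy1
    have : min 1 (y ^ 2) = 1 := min_eq_left (by nlinarith)
    simp only [smul_eq_mul, this, one_mul]
    rw [← Real.rpow_natCast y (N - 1), ← Real.rpow_add hy0, hcast]
    congr 1
    ring

/-- A non-integrable function has integral 0, so integrability comes before positivity. It follows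
from `1 - cos s ≤ min 2 (s ^ 2 / 2)`. The integrand is positive on the open slab `0 < ζ 0 < 1`. -/
lemma normConst_pos [NeZero N] {r : ℝ} (hr0 : 0 < r) (hr1 : r < 1) : 0 < normConst N r := by
  have hnn : ∀ ζ : RN N, 0 ≤ (1 - Real.cos (ζ 0)) / ‖ζ‖ ^ ((N : ℝ) + 2 * r) := fun ζ =>
    div_nonneg (by linarith [Real.cos_le_one (ζ 0)]) (Real.rpow_nonneg (norm_nonneg _) _)
  have hm : Measurable fun ζ : RN N => (1 - Real.cos (ζ 0)) / ‖ζ‖ ^ ((N : ℝ) + 2 * r) := by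
    fun_prop
  have hint : Integrable fun ζ : RN N => (1 - Real.cos (ζ 0)) / ‖ζ‖ ^ ((N : ℝ) + 2 * r) := by
    refine ((integrable_truncatedKernel hr0 hr1).const_mul 2).mono' hm.aestronglyMeasurable
      (ae_of_all _ fun ζ => ?_)
    rw [Real.norm_of_nonneg (hnn ζ), div_norm_rpow_eq_mul_kernel, truncatedKernel, ← mul_assoc]
    refine mul_le_mul_of_nonneg_right ?_ (kernel_nonneg r ζ)
    rw [mul_min_of_nonneg _ _ zero_le_two]
    have h0 : |ζ 0| ≤ ‖ζ‖ := PiLp.norm_apply_le ζ 0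
    have h1 : ζ 0 ^ 2 ≤ ‖ζ‖ ^ 2 := sq_le_sq.mpr (by simpa using h0)
    refine le_min (by linarith [Real.neg_one_le_cos (ζ 0)]) ?_
    nlinarith [Real.one_sub_sq_div_two_le_cos (x := ζ 0), sq_nonneg (ζ 0)]
  refine inv_pos.mpr ((integral_pos_iff_support_of_nonneg hnn hint).mpr ?_)
  have hopen : IsOpen {ζ : RN N | ζ 0 ∈ Ioo (0 : ℝ) 1} :=
    isOpen_Ioo.preimage (by fun_prop)
  have hne : ({ζ : RN N | ζ 0 ∈ Ioo (0 : ℝ) 1}).Nonempty :=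
    ⟨EuclideanSpace.single 0 (1 / 2), by norm_num⟩
  refine (hopen.measure_pos volume hne).trans_le (measure_mono fun ζ hζ => ?_)
  have h0 : 0 < ζ 0 := hζ.1
  have hζ0 : ζ ≠ 0 := by
    rintro rfl
    simp at h0
  have hcos : Real.cos (ζ 0) < 1 := by
    rw [← Real.cos_zero]
    exact Real.cos_lt_cos_of_nonneg_of_le_pi le_rfl (by linarith [hζ.2, Real.pi_gt_three]) h0
  exact (div_pos (by linarith) (Real.rpow_pos_of_pos (norm_pos_iff.mpr hζ0) _)).ne'

/-! ### The weighted difference quotient and the space `𝒳_{r,0}` -/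

/-- The weighted difference `(v(x) - v(y)) √K_r(x - y)`. -/
def nonlocalDiff (r : ℝ) (v : RN N → ℝ) (z : RN N × RN N) : ℝ :=
  (v z.1 - v z.2) * √(kernel r (z.1 - z.2))

lemma nonlocalDiff_mul (r : ℝ) (v φ : RN N → ℝ) (z : RN N × RN N) :
    nonlocalDiff r v z * nonlocalDiff r φ z
      = kernel r (z.1 - z.2) * (v z.1 - v z.2) * (φ z.1 - φ z.2) := by
  have := Real.mul_self_sqrt (kernel_nonneg r (z.1 - z.2))
  unfold nonlocalDiff
  linear_combination (v z.1 - v z.2) * (φ z.1 - φ z.2) * this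

lemma nonlocalDiff_sq (r : ℝ) (v : RN N → ℝ) (z : RN N × RN N) :
    nonlocalDiff r v z ^ 2 = kernel r (z.1 - z.2) * (v z.1 - v z.2) ^ 2 := by
  rw [sq, nonlocalDiff_mul]
  ring

lemma nonlocalDiff_add (r : ℝ) (v w : RN N → ℝ) :
    nonlocalDiff r (v + w) = nonlocalDiff r v + nonlocalDiff r w := by
  ext z
  simp only [nonlocalDiff, Pi.add_apply]
  ring

lemma nonlocalDiff_sub (r : ℝ) (v w : RN N → ℝ) :
    nonlocalDiff r (v - w) = nonlocalDiff r v - nonlocalDiff r w := by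
  ext z
  simp only [nonlocalDiff, Pi.sub_apply]
  ring

lemma nonlocalDiff_smul (r c : ℝ) (v : RN N → ℝ) :
    nonlocalDiff r (c • v) = c • nonlocalDiff r v := by
  ext z
  simp only [nonlocalDiff, Pi.smul_apply, smul_eq_mul]
  ring

/-- The squared Gagliardo seminorm. -/
def gagliardo (r : ℝ) (v : RN N → ℝ) : ℝ := ∫ z, nonlocalDiff r v z ^ 2

lemma gagliardo_nonneg (r : ℝ) (v : RN N → ℝ) : 0 ≤ gagliardo r v :=
  integral_nonneg fun _ => sq_nonneg _

lemma gagliardo_smul (r c : ℝ) (v : RN N → ℝ) : gagliardo r (c • v) = c ^ 2 * gagliardo r v := by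
  simp only [gagliardo, nonlocalDiff_smul, Pi.smul_apply, smul_eq_mul, mul_pow]
  exact integral_const_mul _ _

lemma fracForm_eq [NeZero N] (r : ℝ) (v φ : RN N → ℝ) :
    fracForm r v φ = normConst N r / 2 * ∫ z, nonlocalDiff r v z * nonlocalDiff r φ z := by
  simp only [fracForm, nonlocalDiff_mul]

lemma fracForm_self [NeZero N] (r : ℝ) (v : RN N → ℝ) :
    fracForm r v v = normConst N r / 2 * gagliardo r v := by
  simp only [fracForm_eq, gagliardo, sq]

lemma ae_fst {P : RN N → Prop} (h : ∀ᵐ x, P x) : ∀ᵐ z : RN N × RN N, P z.1 :=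
  Measure.quasiMeasurePreserving_fst.ae h

lemma ae_snd {P : RN N → Prop} (h : ∀ᵐ x, P x) : ∀ᵐ z : RN N × RN N, P z.2 :=
  Measure.quasiMeasurePreserving_snd.ae h

lemma nonlocalDiff_congr_ae (r : ℝ) {v w : RN N → ℝ} (h : v =ᵐ[volume] w) :
    nonlocalDiff r v =ᵐ[volume] nonlocalDiff r w := by
  filter_upwards [ae_fst h, ae_snd h] with z h1 h2
  simp only [nonlocalDiff, h1, h2]

lemma gagliardo_congr_ae (r : ℝ) {v w : RN N → ℝ} (h : v =ᵐ[volume] w) :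
    gagliardo r v = gagliardo r w :=
  integral_congr_ae <| (nonlocalDiff_congr_ae r h).mono fun z hz => by simp only [hz]

lemma aestronglyMeasurable_nonlocalDiff (r : ℝ) {v : RN N → ℝ}
    (h : AEStronglyMeasurable v volume) : AEStronglyMeasurable (nonlocalDiff r v) volume := by
  have h1 : AEStronglyMeasurable (fun z : RN N × RN N => v z.1) volume :=
    h.comp_quasiMeasurePreserving Measure.quasiMeasurePreserving_fst
  have h2 : AEStronglyMeasurable (fun z : RN N × RN N => v z.2) volume :=
    h.comp_quasiMeasurePreserving Measure.quasiMeasurePreserving_snd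
  refine (h1.sub h2).mul (Measurable.aestronglyMeasurable ?_)
  exact ((measurable_kernel r).comp (measurable_fst.sub measurable_snd)).sqrt

/-- Off the interaction set both points lie outside `Ω`, where `v` vanishes a.e., so the restriction
to that set loses nothing. -/
lemma mem_fracSobolevZero_iff {Ω : Set (RN N)} (hΩ : MeasurableSet Ω) (r : ℝ) (v : RN N → ℝ) :
    v ∈ fracSobolevZero Ω r ↔ MemLp v 2 volume ∧ (∀ᵐ x, x ∉ Ω → v x = 0) ∧
      MemLp (nonlocalDiff r v) 2 volume := by
  have hQ : MeasurableSet (interactionSet Ω) := (hΩ.compl.prod hΩ.compl).compl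
  unfold fracSobolevZero L2Zero
  simp only [mem_ofPred_eq, and_assoc]
  refine and_congr_right fun _ => and_congr_right fun h0 => ?_
  change MemLp (nonlocalDiff r v) 2 _ ↔ _
  rw [← memLp_indicator_iff_restrict hQ]
  refine memLp_congr_ae ?_
  filter_upwards [ae_fst h0, ae_snd h0] with z h1 h2
  by_cases hz : z ∈ interactionSet Ω
  · rw [indicator_of_mem hz]
  · rw [indicator_of_notMem hz]
    simp only [interactionSet, mem_compl_iff, not_not, mem_prod] at hz
    simp [nonlocalDiff, h1 hz.1, h2 hz.2]

/-! ### Linear operations and Lipschitz truncations in `𝒳_{r,0}`. -/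

section Membership

variable {Ω : Set (RN N)} {r : ℝ} {v w : RN N → ℝ}

lemma memLp_of_mem (hv : v ∈ fracSobolevZero Ω r) : MemLp v 2 volume := hv.1.1

lemma ae_eq_zero_of_mem (hv : v ∈ fracSobolevZero Ω r) : ∀ᵐ x, x ∉ Ω → v x = 0 := hv.1.2

lemma memLp_nonlocalDiff_of_mem (hΩ : MeasurableSet Ω) (hv : v ∈ fracSobolevZero Ω r) :
    MemLp (nonlocalDiff r v) 2 volume := ((mem_fracSobolevZero_iff hΩ r v).mp hv).2.2

lemma add_mem_fracSobolevZero (hΩ : MeasurableSet Ω) (hv : v ∈ fracSobolevZero Ω r)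
    (hw : w ∈ fracSobolevZero Ω r) : v + w ∈ fracSobolevZero Ω r := by
  rw [mem_fracSobolevZero_iff hΩ] at *
  refine ⟨hv.1.add hw.1, ?_, ?_⟩
  · filter_upwards [hv.2.1, hw.2.1] with x h1 h2 hx
    simp [h1 hx, h2 hx]
  · rw [nonlocalDiff_add]
    exact hv.2.2.add hw.2.2

lemma smul_mem_fracSobolevZero (hΩ : MeasurableSet Ω) (c : ℝ) (hv : v ∈ fracSobolevZero Ω r) :
    c • v ∈ fracSobolevZero Ω r := by
  rw [mem_fracSobolevZero_iff hΩ] at *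
  refine ⟨hv.1.const_smul c, ?_, ?_⟩
  · filter_upwards [hv.2.1] with x h1 hx
    simp [h1 hx]
  · rw [nonlocalDiff_smul]
    exact hv.2.2.const_smul c

lemma sub_mem_fracSobolevZero (hΩ : MeasurableSet Ω) (hv : v ∈ fracSobolevZero Ω r)
    (hw : w ∈ fracSobolevZero Ω r) : v - w ∈ fracSobolevZero Ω r := by
  have h := add_mem_fracSobolevZero hΩ hv (smul_mem_fracSobolevZero hΩ (-1) hw)
  rwa [neg_one_smul, ← sub_eq_add_neg] at h

lemma norm_nonlocalDiff_comp_le {T : ℝ → ℝ} (hT : LipschitzWith 1 T) (z : RN N × RN N) :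
    ‖nonlocalDiff r (T ∘ v) z‖ ≤ ‖nonlocalDiff r v z‖ := by
  simp only [nonlocalDiff, norm_mul, Function.comp]
  refine mul_le_mul_of_nonneg_right ?_ (norm_nonneg _)
  simpa [Real.dist_eq] using hT.dist_le_mul (v z.1) (v z.2)

lemma comp_mem_fracSobolevZero (hΩ : MeasurableSet Ω) {T : ℝ → ℝ} (hT : LipschitzWith 1 T)
    (hT0 : T 0 = 0) (hv : v ∈ fracSobolevZero Ω r) : T ∘ v ∈ fracSobolevZero Ω r := by
  rw [mem_fracSobolevZero_iff hΩ] at *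
  have h2 : MemLp (T ∘ v) 2 volume := hT.comp_memLp hT0 hv.1
  refine ⟨h2, ?_, ?_⟩
  · filter_upwards [hv.2.1] with x h1 hx
    simp [h1 hx, hT0]
  · exact hv.2.2.of_le (aestronglyMeasurable_nonlocalDiff r h2.1)
      (ae_of_all _ (norm_nonlocalDiff_comp_le hT))

lemma gagliardo_comp_le (hΩ : MeasurableSet Ω) {T : ℝ → ℝ} (hT : LipschitzWith 1 T)
    (hT0 : T 0 = 0) (hv : v ∈ fracSobolevZero Ω r) : gagliardo r (T ∘ v) ≤ gagliardo r v := by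
  refine integral_mono
    (memLp_nonlocalDiff_of_mem hΩ (comp_mem_fracSobolevZero hΩ hT hT0 hv)).integrable_sq
    (memLp_nonlocalDiff_of_mem hΩ hv).integrable_sq fun z => ?_
  have := norm_nonlocalDiff_comp_le (r := r) (v := v) hT z
  exact sq_le_sq.mpr this

end Membership

/-- A nonempty open set carries a nonzero Lipschitz function in `𝒳_{r,0}`. -/
lemma exists_mem_fracSobolevZero_ne_zero [NeZero N] {Ω : Set (RN N)} (hΩo : IsOpen Ω)
    (hΩb : Bornology.IsBounded Ω) (hΩne : Ω.Nonempty) {r : ℝ} (hr0 : 0 < r) (hr1 : r < 1) :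
    ∃ v ∈ fracSobolevZero Ω r, ¬ (v =ᵐ[volume] 0) := by
  obtain ⟨x₀, hx₀⟩ := hΩne
  obtain ⟨ρ', hρ', hball'⟩ := Metric.isOpen_iff.mp hΩo x₀ hx₀
  obtain ⟨ρ, hρ, hρ1, hball⟩ : ∃ ρ : ℝ, 0 < ρ ∧ ρ ≤ 1 ∧ Metric.ball x₀ ρ ⊆ Ω :=
    ⟨min ρ' 1, lt_min hρ' one_pos, min_le_right _ _,
      (Metric.ball_subset_ball (min_le_left _ _)).trans hball'⟩
  -- A tent over a ball in `Ω`. The radius is at most 1, so `v` is 1-Lipschitz with values in `[0,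
  -- 1]`, and its squared differences are at most `min 1 (‖x - y‖ ^ 2)`.
  set v : RN N → ℝ := fun x => max (ρ - dist x x₀) 0 with hv
  have hcont : Continuous v := by fun_prop
  have hv0 : ∀ x, 0 ≤ v x := fun x => le_max_right _ _
  have hvρ : ∀ x, v x ≤ 1 := fun x =>
    max_le (by linarith [dist_nonneg (x := x) (y := x₀)]) zero_le_one
  have hout : ∀ x, x ∉ Ω → v x = 0 := fun x hx => by
    have : ρ ≤ dist x x₀ := not_lt.mp fun h => hx (hball h)
    exact max_eq_right (by linarith)
  have hfin : volume Ω < ⊤ := hΩb.measure_lt_top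
  have hind : Integrable (Ω.indicator (fun _ => (1 : ℝ))) :=
    (integrable_indicator_iff hΩo.measurableSet).mpr (integrableOn_const hfin.ne)
  have hL2 : MemLp v 2 volume := by
    have h1 : MemLp (Ω.indicator (fun _ => (1 : ℝ))) 2 volume :=
      memLp_indicator_const 2 hΩo.measurableSet 1 (Or.inr hfin.ne)
    refine h1.of_le hcont.aestronglyMeasurable (ae_of_all _ fun x => ?_)
    by_cases hx : x ∈ Ω
    · simpa [hx, abs_of_nonneg (hv0 x)] using hvρ x
    · simp [hx, hout x hx]
  have hdiff : ∀ x y, (v x - v y) ^ 2 ≤ min 1 (‖x - y‖ ^ 2) := fun x y => by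
    refine le_min ?_ ?_
    · have := hv0 x; have := hv0 y; have := hvρ x; have := hvρ y
      rw [sq_le_one_iff_abs_le_one, abs_le]
      constructor <;> linarith
    · rw [sq_le_sq, abs_norm]
      refine (abs_max_sub_max_le_abs _ _ _).trans ?_
      rw [sub_sub_sub_cancel_left, ← dist_eq_norm, dist_comm x y]
      exact abs_dist_sub_le y x x₀
  refine ⟨v, (mem_fracSobolevZero_iff hΩo.measurableSet r v).mpr
    ⟨hL2, ae_of_all _ hout, ?_⟩, fun h => ?_⟩
  · rw [memLp_two_iff_integrable_sq (aestronglyMeasurable_nonlocalDiff r hL2.1)]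
    -- The map `(x, y) ↦ (x - y, y)` preserves the measure and turns this function into a product of
    -- integrable factors.
    have hI2 : Integrable (fun z : RN N × RN N =>
        truncatedKernel r (z.1 - z.2) * Ω.indicator (fun _ => (1 : ℝ)) z.2) :=
      (measurePreserving_sub_prod volume volume).integrable_comp_of_integrable
        ((integrable_truncatedKernel hr0 hr1).mul_prod hind)
    have hI1 : Integrable (fun z : RN N × RN N =>
        truncatedKernel r (z.1 - z.2) * Ω.indicator (fun _ => (1 : ℝ)) z.1) := by
      have := hI2.swap
      refine this.congr (ae_of_all _ fun z => ?_)
      simp only [Function.comp, Prod.fst_swap, Prod.snd_swap]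
      congr 1
      simp only [truncatedKernel, ← neg_sub z.1 z.2, norm_neg, kernel_neg]
    refine (hI1.add hI2).mono'
      ((aestronglyMeasurable_nonlocalDiff r hL2.1).pow 2) (ae_of_all _ fun z => ?_)
    rw [Real.norm_of_nonneg (sq_nonneg _), nonlocalDiff_sq]
    have hk := kernel_nonneg r (z.1 - z.2)
    have h1 : kernel r (z.1 - z.2) * (v z.1 - v z.2) ^ 2 ≤ truncatedKernel r (z.1 - z.2) := by
      rw [truncatedKernel, mul_comm]
      exact mul_le_mul_of_nonneg_right (hdiff _ _) hk
    have h2 := truncatedKernel_nonneg r (z.1 - z.2)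
    by_cases hz1 : z.1 ∈ Ω <;> by_cases hz2 : z.2 ∈ Ω <;>
      simp [hz1, hz2, hout] at h1 ⊢ <;> linarith
  · have h0 : v = 0 := (hcont.ae_eq_iff_eq volume continuous_const).mp h
    have h1 : v x₀ = ρ := by simp [hv, hρ.le]
    rw [h0] at h1
    exact hρ.ne h1

/-! ### Fatou's lemma for real integrals -/

/-- Integrability of the limit is a conclusion: it is what places weak limits in `𝒳_{r,0}` and in
`L^p`. -/
lemma integrable_and_integral_le_of_tendsto {α : Type*} [MeasurableSpace α] {μ : Measure α}
    {f : ℕ → α → ℝ} {g : α → ℝ} {c : ℝ} (hf : ∀ n, Integrable (f n) μ) (h0 : ∀ n x, 0 ≤ f n x)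
    (hg : AEStronglyMeasurable g μ) (h : ∀ᵐ x ∂μ, Tendsto (fun n => f n x) atTop (𝓝 (g x)))
    (hc : Tendsto (fun n => ∫ x, f n x ∂μ) atTop (𝓝 c)) :
    Integrable g μ ∧ ∫ x, g x ∂μ ≤ c := by
  have hg0 : 0 ≤ᵐ[μ] g := h.mono fun x hx => ge_of_tendsto' hx fun n => h0 n x
  have hc0 : 0 ≤ c := ge_of_tendsto' hc fun n => integral_nonneg (h0 n)
  have key : ∫⁻ x, ENNReal.ofReal (g x) ∂μ ≤ ENNReal.ofReal c := by
    calc ∫⁻ x, ENNReal.ofReal (g x) ∂μ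
        = ∫⁻ x, liminf (fun n => ENNReal.ofReal (f n x)) atTop ∂μ := by
          refine lintegral_congr_ae (h.mono fun x hx => ?_)
          exact ((ENNReal.continuous_ofReal.tendsto _).comp hx).liminf_eq.symm
      _ ≤ liminf (fun n => ∫⁻ x, ENNReal.ofReal (f n x) ∂μ) atTop :=
          lintegral_liminf_le' fun n => (hf n).1.aemeasurable.ennreal_ofReal
      _ = liminf (fun n => ENNReal.ofReal (∫ x, f n x ∂μ)) atTop := by
          simp_rw [ofReal_integral_eq_lintegral_ofReal (hf _) (ae_of_all _ (h0 _))]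
      _ = ENNReal.ofReal c := ((ENNReal.continuous_ofReal.tendsto _).comp hc).liminf_eq
  refine ⟨⟨hg, ?_⟩, ?_⟩
  · rw [hasFiniteIntegral_iff_ofReal hg0]
    exact key.trans_lt ENNReal.ofReal_lt_top
  · rw [integral_eq_lintegral_of_nonneg_ae hg0 hg]
    exact ENNReal.toReal_le_of_le_ofReal hc0 key

/-! ### A Poincaré inequality on small cubes -/

/-- The variance identity. It yields the Poincaré inequality on a cube when the left side is bounded
by the seminorm, and Cauchy–Schwarz when it is only known to be nonnegative. -/
lemma integral_prod_sub_sq {α : Type*} [MeasurableSpace α] (ν : Measure α) [IsFiniteMeasure ν]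
    {f : α → ℝ} (hf : MemLp f 2 ν) :
    Integrable (fun z : α × α => (f z.1 - f z.2) ^ 2) (ν.prod ν) ∧
    ∫ z, (f z.1 - f z.2) ^ 2 ∂(ν.prod ν)
      = 2 * (ν.real univ * ∫ x, f x ^ 2 ∂ν) - 2 * (∫ x, f x ∂ν) ^ 2 := by
  have h1 : Integrable f ν := hf.integrable one_le_two
  have h2 : Integrable (fun x => f x ^ 2) ν := hf.integrable_sq
  have hone : Integrable (fun _ : α => (1 : ℝ)) ν := integrable_const 1
  have e : (fun z : α × α => (f z.1 - f z.2) ^ 2)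
      = fun z => (f z.1 ^ 2 * 1 + 1 * f z.2 ^ 2) - 2 * (f z.1 * f z.2) := by
    ext z
    ring
  have i1 := h2.mul_prod hone
  have i2 := hone.mul_prod h2
  have i12 : Integrable (fun z : α × α => f z.1 ^ 2 * 1 + 1 * f z.2 ^ 2) (ν.prod ν) := i1.add i2
  have i3 := (h1.mul_prod h1).const_mul 2
  rw [e]
  refine ⟨i12.sub i3, ?_⟩
  rw [integral_sub i12 i3, integral_add i1 i2,
    integral_prod_mul (fun x => f x ^ 2) (fun _ => (1 : ℝ)),
    integral_prod_mul (fun _ => (1 : ℝ)) (fun x => f x ^ 2), integral_const_mul,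
    integral_prod_mul f f]
  simp only [integral_const, smul_eq_mul, mul_one]
  ring

/-- The half-open cube of side `h` with index `k`. -/
def gridCube (h : ℝ) (k : Fin N → ℤ) : Set (RN N) := {x | ∀ i, ⌊x i / h⌋ = k i}

lemma measurableSet_gridCube (h : ℝ) (k : Fin N → ℤ) : MeasurableSet (gridCube h k) := by
  have : gridCube h k = ⋂ i, {x : RN N | ⌊x i / h⌋ = k i} := by
    ext x
    simp [gridCube]
  rw [this]
  refine MeasurableSet.iInter fun i => ?_
  have hm : Measurable fun x : RN N => ⌊x i / h⌋ := by fun_prop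
  exact hm (measurableSet_singleton _)

lemma pairwise_disjoint_gridCube (h : ℝ) :
    Pairwise (Function.onFun Disjoint (gridCube (N := N) h)) := by
  intro k l hkl
  refine Set.disjoint_left.mpr fun x hk hl => hkl ?_
  ext i
  rw [← hk i, ← hl i]

lemma volume_gridCube {h : ℝ} (hh : 0 < h) (k : Fin N → ℤ) :
    volume (gridCube h k) = ENNReal.ofReal (h ^ N) := by
  have e : gridCube h k = (@WithLp.ofLp 2 (Fin N → ℝ)) ⁻¹'
      (univ.pi fun i => Ico ((k i : ℝ) * h) ((k i + 1) * h)) := by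
    ext x
    simp only [gridCube, mem_ofPred_eq, mem_preimage, Set.mem_pi, mem_univ, true_implies, mem_Ico,
      Int.floor_eq_iff, le_div_iff₀ hh, div_lt_iff₀ hh]
  rw [e, (PiLp.volume_preserving_ofLp (Fin N)).measure_preimage
    (MeasurableSet.univ_pi fun _ => measurableSet_Ico).nullMeasurableSet, Real.volume_pi_Ico]
  simp only [add_mul, one_mul, add_sub_cancel_left, Finset.prod_const, Finset.card_univ,
    Fintype.card_fin, ENNReal.ofReal_pow hh.le]

lemma norm_sub_le_of_mem_gridCube {h : ℝ} (hh : 0 < h) {k : Fin N → ℤ} {x y : RN N}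
    (hx : x ∈ gridCube h k) (hy : y ∈ gridCube h k) : ‖x - y‖ ≤ √N * h := by
  rw [EuclideanSpace.norm_eq, ← Real.sqrt_sq hh.le, ← Real.sqrt_mul (Nat.cast_nonneg N)]
  refine Real.sqrt_le_sqrt ?_
  have : ∀ i ∈ Finset.univ, ‖(x - y).ofLp i‖ ^ 2 ≤ h ^ 2 := fun i _ => by
    have h1 := Int.abs_sub_lt_one_of_floor_eq_floor ((hx i).trans (hy i).symm)
    rw [← sub_div, abs_div, abs_of_pos hh, div_lt_one hh] at h1
    refine pow_le_pow_left₀ (norm_nonneg _) ?_ 2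
    simpa using h1.le
  simpa using Finset.sum_le_sum this

lemma exists_finset_gridCube_cover {h : ℝ} (hh : 0 < h) {Ω : Set (RN N)}
    (hΩb : Bornology.IsBounded Ω) :
    ∃ t : Finset (Fin N → ℤ), Ω ⊆ ⋃ k ∈ t, gridCube h k := by
  obtain ⟨R, hR⟩ := hΩb.exists_norm_le
  refine ⟨Fintype.piFinset fun _ => Finset.Icc ⌊-R / h⌋ ⌊R / h⌋, fun x hx => ?_⟩
  simp only [mem_iUnion, Fintype.mem_piFinset, Finset.mem_Icc]
  refine ⟨fun i => ⌊x i / h⌋, fun i => ?_, fun i => rfl⟩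
  have := abs_le.mp ((PiLp.norm_apply_le x i).trans (hR x hx))
  have h1 : -R / h ≤ x i / h := div_le_div_of_nonneg_right this.1 hh.le
  have h2 : x i / h ≤ R / h := div_le_div_of_nonneg_right this.2 hh.le
  exact ⟨Int.floor_le_floor h1, Int.floor_le_floor h2⟩

section Cube

variable {Ω : Set (RN N)} {r : ℝ} {v w : RN N → ℝ}

/-- On `Q × Q` one has `‖x - y‖ ≤ √N * h`, so off the diagonal `1 ≤ (√N * h) ^ (N + 2 * r) * kernel
r (x - y)`. Inserting this in the variance identity bounds the variance by the local seminorm. -/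
lemma setIntegral_sq_le (hr : 0 < r) (hΩ : MeasurableSet Ω) (hv : v ∈ fracSobolevZero Ω r)
    {h : ℝ} (hh : 0 < h) (k : Fin N → ℤ) :
    ∫ x in gridCube h k, v x ^ 2 ≤
      (√N * h) ^ ((N : ℝ) + 2 * r) / (2 * h ^ N) *
          (∫ z in gridCube h k ×ˢ gridCube h k, nonlocalDiff r v z ^ 2)
        + (∫ x in gridCube h k, v x) ^ 2 / h ^ N := by
  set Q := gridCube h k with hQ
  have hQm : MeasurableSet Q := measurableSet_gridCube h k
  have hvol : volume Q = ENNReal.ofReal (h ^ N) := volume_gridCube hh k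
  have hhN : 0 < h ^ N := pow_pos hh N
  have : IsFiniteMeasure (volume.restrict Q) :=
    ⟨by rw [Measure.restrict_apply_univ, hvol]; exact ENNReal.ofReal_lt_top⟩
  have hreal : (volume.restrict Q).real univ = h ^ N := by
    rw [measureReal_restrict_apply_univ, measureReal_def, hvol, ENNReal.toReal_ofReal hhN.le]
  obtain ⟨hint, hid⟩ := integral_prod_sub_sq (volume.restrict Q) ((memLp_of_mem hv).restrict Q)
  rw [hreal] at hid
  have hdiff := (memLp_nonlocalDiff_of_mem hΩ hv).integrable_sq
  have hle : ∫ z, (v z.1 - v z.2) ^ 2 ∂((volume.restrict Q).prod (volume.restrict Q)) ≤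
      (√N * h) ^ ((N : ℝ) + 2 * r) * ∫ z in Q ×ˢ Q, nonlocalDiff r v z ^ 2 := by
    rw [← integral_const_mul]
    rw [Measure.prod_restrict, ← Measure.volume_eq_prod] at hint ⊢
    refine setIntegral_mono_on hint (hdiff.const_mul _).integrableOn (hQm.prod hQm)
      fun z hz => ?_
    rw [nonlocalDiff_sq, ← mul_assoc]
    -- On the diagonal `kernel` takes the value 0 and the lower bound fails, but the difference of
    -- `v` vanishes.
    by_cases hz0 : z.1 = z.2
    · simp [hz0]
    refine le_mul_of_one_le_left (sq_nonneg _) ?_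
    have hpos : 0 < ‖z.1 - z.2‖ := norm_pos_iff.mpr (sub_ne_zero.mpr hz0)
    have hk : kernel r (z.1 - z.2) = (‖z.1 - z.2‖ ^ ((N : ℝ) + 2 * r))⁻¹ := by
      rw [kernel, ← Real.rpow_neg hpos.le]
      congr 1
      ring
    rw [hk, ← div_eq_mul_inv, one_le_div (Real.rpow_pos_of_pos hpos _)]
    exact Real.rpow_le_rpow hpos.le (norm_sub_le_of_mem_gridCube hh hz.1 hz.2) (by positivity)
  rw [hid] at hle
  rw [div_mul_eq_mul_div, div_add_div _ _ (by positivity) hhN.ne', le_div_iff₀ (by positivity)]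
  nlinarith

/-- The products `Q_k × Q_k` are disjoint, so the local seminorms add up to at most the global one;
interactions between distinct cubes are dropped. -/
lemma integral_sq_le_sum (hr : 0 < r) (hΩ : MeasurableSet Ω) (hv : v ∈ fracSobolevZero Ω r)
    {h : ℝ} (hh : 0 < h) {t : Finset (Fin N → ℤ)} (ht : Ω ⊆ ⋃ k ∈ t, gridCube h k) :
    ∫ x, v x ^ 2 ≤ (√N * h) ^ ((N : ℝ) + 2 * r) / (2 * h ^ N) * gagliardo r v
      + ∑ k ∈ t, (∫ x in gridCube h k, v x) ^ 2 / h ^ N := by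
  have hsq := (memLp_of_mem hv).integrable_sq
  have hdiff := (memLp_nonlocalDiff_of_mem hΩ hv).integrable_sq
  have hdisj := pairwise_disjoint_gridCube (N := N) h
  have h1 : ∫ x, v x ^ 2 = ∑ k ∈ t, ∫ x in gridCube h k, v x ^ 2 := by
    rw [← integral_biUnion_finset t (fun k _ => measurableSet_gridCube h k)
      (hdisj.set_pairwise _) (fun k _ => hsq.integrableOn)]
    refine (setIntegral_eq_integral_of_ae_compl_eq_zero ?_).symm
    filter_upwards [ae_eq_zero_of_mem hv] with x hx hx'
    rw [hx fun h => hx' (ht h)]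
    norm_num
  have h2 : ∑ k ∈ t, ∫ z in gridCube h k ×ˢ gridCube h k, nonlocalDiff r v z ^ 2
      ≤ gagliardo r v := by
    rw [← integral_biUnion_finset t
      (fun k _ => (measurableSet_gridCube h k).prod (measurableSet_gridCube h k)) ?_
      (fun k _ => hdiff.integrableOn)]
    · exact setIntegral_le_integral hdiff (ae_of_all _ fun _ => sq_nonneg _)
    · intro k _ l _ hkl
      exact Disjoint.set_prod_left (hdisj hkl) _ _
  rw [h1]
  refine (Finset.sum_le_sum fun k _ => setIntegral_sq_le hr hΩ hv hh k).trans ?_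
  rw [Finset.sum_add_distrib, ← Finset.mul_sum]
  gcongr

lemma sq_setIntegral_gridCube_le (hv : MemLp v 2 volume) {h : ℝ} (hh : 0 < h)
    (k : Fin N → ℤ) : (∫ x in gridCube h k, v x) ^ 2 ≤ h ^ N * ∫ x, v x ^ 2 := by
  have hvol := volume_gridCube hh k
  have hhN : 0 < h ^ N := pow_pos hh N
  have : IsFiniteMeasure (volume.restrict (gridCube h k)) :=
    ⟨by rw [Measure.restrict_apply_univ, hvol]; exact ENNReal.ofReal_lt_top⟩
  have hreal : (volume.restrict (gridCube h k)).real univ = h ^ N := by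
    rw [measureReal_restrict_apply_univ, measureReal_def, hvol, ENNReal.toReal_ofReal hhN.le]
  obtain ⟨-, hid⟩ := integral_prod_sub_sq (volume.restrict (gridCube h k)) (hv.restrict _)
  rw [hreal] at hid
  have h0 : 0 ≤ ∫ z, (v z.1 - v z.2) ^ 2
      ∂((volume.restrict (gridCube h k)).prod (volume.restrict (gridCube h k))) :=
    integral_nonneg fun _ => sq_nonneg _
  have h1 : ∫ x in gridCube h k, v x ^ 2 ≤ ∫ x, v x ^ 2 :=
    setIntegral_le_integral hv.integrable_sq (ae_of_all _ fun _ => sq_nonneg _)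
  nlinarith [mul_le_mul_of_nonneg_left h1 hhN.le]

lemma gagliardo_sub_le (hΩ : MeasurableSet Ω) (hv : v ∈ fracSobolevZero Ω r)
    (hw : w ∈ fracSobolevZero Ω r) :
    gagliardo r (v - w) ≤ 2 * gagliardo r v + 2 * gagliardo r w := by
  have h1 := (memLp_nonlocalDiff_of_mem hΩ hv).integrable_sq.const_mul 2
  have h2 := (memLp_nonlocalDiff_of_mem hΩ hw).integrable_sq.const_mul 2
  have h3 := (memLp_nonlocalDiff_of_mem hΩ (sub_mem_fracSobolevZero hΩ hv hw)).integrable_sq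
  unfold gagliardo
  rw [← integral_const_mul, ← integral_const_mul, ← integral_add h1 h2]
  refine integral_mono h3 (h1.add h2) fun z => ?_
  simp only [nonlocalDiff_sub, Pi.sub_apply]
  nlinarith [sq_nonneg (nonlocalDiff r v z + nonlocalDiff r w z)]

lemma mem_fracSobolevZero_congr (hΩ : MeasurableSet Ω) (h : v =ᵐ[volume] w)
    (hv : v ∈ fracSobolevZero Ω r) : w ∈ fracSobolevZero Ω r := by
  rw [mem_fracSobolevZero_iff hΩ] at *
  refine ⟨(memLp_congr_ae h).mp hv.1, ?_, (memLp_congr_ae (nonlocalDiff_congr_ae r h)).mp hv.2.2⟩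
  filter_upwards [h, hv.2.1] with x h1 h2 hx
  rw [← h1, h2 hx]

end Cube

/-! ### The compact embedding into `L²` -/

lemma norm_sq_eq_integral {α : Type*} [MeasurableSpace α] {μ : Measure α} (f : Lp ℝ 2 μ) :
    ‖f‖ ^ 2 = ∫ x, f x ^ 2 ∂μ := by
  rw [← real_inner_self_eq_norm_sq, L2.inner_def]
  simp [sq]

/-- The functions of `𝒳_{r,0}` bounded by `M` in norm, as a subset of `L²`. -/
def sobolevBall (Ω : Set (RN N)) (r M : ℝ) : Set (Lp ℝ 2 (volume : Measure (RN N))) :=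
  {f | (f : RN N → ℝ) ∈ fracSobolevZero Ω r ∧ ∫ x, f x ^ 2 ≤ M ∧ gagliardo r f ≤ M}

/-- The factor `h ^ N` cancels and leaves `h ^ (2 * r)`. -/
lemma tendsto_poincare_const (N : ℕ) {r : ℝ} (hr : 0 < r) :
    Tendsto (fun h : ℝ => (√N * h) ^ ((N : ℝ) + 2 * r) / (2 * h ^ N)) (𝓝[>] 0) (𝓝 0) := by
  have h1 : Tendsto (fun h : ℝ => √N ^ ((N : ℝ) + 2 * r) / 2 * h ^ (2 * r)) (𝓝[>] 0) (𝓝 0) := by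
    have h2 : Tendsto (fun h : ℝ => h ^ (2 * r)) (𝓝[>] 0) (𝓝 0) := by
      have := (Real.continuousAt_rpow_const 0 (2 * r) (Or.inr (by positivity))).tendsto
      rw [Real.zero_rpow (by positivity)] at this
      exact this.mono_left nhdsWithin_le_nhds
    simpa using h2.const_mul (√N ^ ((N : ℝ) + 2 * r) / 2)
  refine h1.congr' (eventually_mem_nhdsWithin.mono fun h hh => ?_)
  have hh : 0 < h := hh
  simp only
  rw [Real.mul_rpow (Real.sqrt_nonneg _) hh.le, Real.rpow_add hh, Real.rpow_natCast]
  field_simp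

/-- For small `h` the seminorm term of the Poincaré inequality is below `ε ^ 2 / 2`. The vector of
cube integrals stays in a compact ball of a finite-dimensional space, and functions whose vectors
are `δ`-close are `ε`-close in `L²`. -/
lemma totallyBounded_sobolevBall {Ω : Set (RN N)} (hΩ : MeasurableSet Ω)
    (hΩb : Bornology.IsBounded Ω) {r : ℝ} (hr : 0 < r) (M : ℝ) :
    TotallyBounded (sobolevBall Ω r M) := by
  refine Metric.totallyBounded_of_finite_discretization fun ε hε => ?_
  -- By `gagliardo_sub_le`, `4 * M` bounds the squared seminorm of a difference of two members.
  obtain ⟨h, hh, hhε⟩ : ∃ h : ℝ, 0 < h ∧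
      (√N * h) ^ ((N : ℝ) + 2 * r) / (2 * h ^ N) * (4 * M) < ε ^ 2 / 2 := by
    have h1 := (tendsto_poincare_const N hr).mul_const (4 * M)
    rw [zero_mul] at h1
    obtain ⟨h, h2, h3⟩ :=
      ((h1.eventually_lt_const (by positivity : 0 < ε ^ 2 / 2)).and eventually_mem_nhdsWithin).exists
    exact ⟨h, h3, h2⟩
  have hhN : 0 < h ^ N := pow_pos hh N
  obtain ⟨t, ht⟩ := exists_finset_gridCube_cover hh hΩb
  obtain ⟨δ, hδ, hδε⟩ : ∃ δ : ℝ, 0 < δ ∧ t.card * (δ ^ 2 / h ^ N) < ε ^ 2 / 2 := by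
    have h1 : Tendsto (fun δ : ℝ => t.card * (δ ^ 2 / h ^ N)) (𝓝[>] 0) (𝓝 0) := by
      have : Continuous fun δ : ℝ => t.card * (δ ^ 2 / h ^ N) := by fun_prop
      simpa using (this.tendsto 0).mono_left nhdsWithin_le_nhds
    obtain ⟨δ, h2, h3⟩ :=
      ((h1.eventually_lt_const (by positivity : 0 < ε ^ 2 / 2)).and eventually_mem_nhdsWithin).exists
    exact ⟨δ, h3, h2⟩
  let T : Lp ℝ 2 (volume : Measure (RN N)) → t → ℝ := fun f k => ∫ x in gridCube h k, f x
  have hT : ∀ f ∈ sobolevBall Ω r M, T f ∈ Metric.closedBall 0 √(h ^ N * M) := fun f hf => by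
    rw [mem_closedBall_zero_iff, pi_norm_le_iff_of_nonneg (Real.sqrt_nonneg _)]
    intro k
    refine Real.abs_le_sqrt ((sq_setIntegral_gridCube_le (memLp_of_mem hf.1) hh k).trans ?_)
    exact mul_le_mul_of_nonneg_left hf.2.1 hhN.le
  obtain ⟨s, hs, hcover⟩ := Metric.totallyBounded_iff.mp
    (isCompact_closedBall (0 : t → ℝ) √(h ^ N * M)).totallyBounded (δ / 2) (by positivity)
  have : Fintype s := hs.fintype
  have hchoice : ∀ f : sobolevBall Ω r M, ∃ c : s, T f ∈ Metric.ball (c : t → ℝ) (δ / 2) := by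
    intro f
    have h1 := hcover (hT f f.2)
    simp only [mem_iUnion] at h1
    obtain ⟨c, hc, h2⟩ := h1
    exact ⟨⟨c, hc⟩, h2⟩
  choose F hF using hchoice
  refine ⟨s, inferInstance, F, fun f g hfg => ?_⟩
  have hTd : dist (T f) (T g) < δ := by
    have h1 := Metric.mem_ball.mp (hF f)
    have h2 := Metric.mem_ball.mp (hF g)
    rw [← hfg] at h2
    linarith [dist_triangle_right (T f) (T g) (F f)]
  obtain ⟨f, hf⟩ := f
  obtain ⟨g, hg⟩ := g
  have hsub : ((f : RN N → ℝ) - (g : RN N → ℝ)) ∈ fracSobolevZero Ω r := sub_mem_fracSobolevZero hΩ hf.1 hg.1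
  have hgag : gagliardo r ((f : RN N → ℝ) - (g : RN N → ℝ)) ≤ 4 * M := by
    linarith [gagliardo_sub_le hΩ hf.1 hg.1, hf.2.2, hg.2.2]
  have hmain := integral_sq_le_sum hr hΩ hsub hh ht
  have hsum : ∑ k ∈ t, (∫ x in gridCube h k, ((f : RN N → ℝ) - (g : RN N → ℝ)) x) ^ 2 / h ^ N
      ≤ t.card * (δ ^ 2 / h ^ N) := by
    rw [← nsmul_eq_mul]
    refine Finset.sum_le_card_nsmul _ _ _ fun k hk => ?_
    refine div_le_div_of_nonneg_right ?_ hhN.le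
    have hvol := volume_gridCube hh k
    have : IsFiniteMeasure (volume.restrict (gridCube h k)) :=
      ⟨by rw [Measure.restrict_apply_univ, hvol]; exact ENNReal.ofReal_lt_top⟩
    have i1 : Integrable f (volume.restrict (gridCube h k)) :=
      ((memLp_of_mem hf.1).restrict _).integrable one_le_two
    have i2 : Integrable g (volume.restrict (gridCube h k)) :=
      ((memLp_of_mem hg.1).restrict _).integrable one_le_two
    have h1 : ∫ x in gridCube h k, ((f : RN N → ℝ) - (g : RN N → ℝ)) x = T f ⟨k, hk⟩ - T g ⟨k, hk⟩ :=
      integral_sub i1 i2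
    rw [h1, sq_le_sq, abs_of_pos hδ, ← Real.dist_eq]
    exact (dist_le_pi_dist (T f) (T g) ⟨k, hk⟩).trans hTd.le
  have hdist : dist f g ^ 2 = ∫ x, ((f : RN N → ℝ) - (g : RN N → ℝ)) x ^ 2 := by
    rw [dist_eq_norm, norm_sq_eq_integral]
    exact integral_congr_ae ((Lp.coeFn_sub f g).mono fun x hx => by simp only [hx])
  refine lt_of_pow_lt_pow_left₀ 2 hε.le ?_
  have hC : 0 ≤ (√N * h) ^ ((N : ℝ) + 2 * r) / (2 * h ^ N) := by positivity
  change dist f g ^ 2 < ε ^ 2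
  linarith [mul_le_mul_of_nonneg_left hgag hC]

/-- A bounded sequence in `𝒳_{r,0}` has a subsequence that converges almost everywhere and in
`L²`, with a limit in `𝒳_{r,0}` along which the Gagliardo seminorm is lower semicontinuous. -/
lemma exists_subseq_tendsto {Ω : Set (RN N)} (hΩ : MeasurableSet Ω)
    (hΩb : Bornology.IsBounded Ω) {r : ℝ} (hr : 0 < r) {M : ℝ} {v : ℕ → RN N → ℝ}
    (hv : ∀ n, v n ∈ fracSobolevZero Ω r) (hM : ∀ n, ∫ x, v n x ^ 2 ≤ M)
    (hG : ∀ n, gagliardo r (v n) ≤ M) :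
    ∃ u ∈ fracSobolevZero Ω r, ∃ φ : ℕ → ℕ, StrictMono φ ∧ ∃ a : ℝ,
      (∀ᵐ x, Tendsto (fun n => v (φ n) x) atTop (𝓝 (u x))) ∧
      Tendsto (fun n => ∫ x, v (φ n) x ^ 2) atTop (𝓝 (∫ x, u x ^ 2)) ∧
      Tendsto (fun n => gagliardo r (v (φ n))) atTop (𝓝 a) ∧ gagliardo r u ≤ a := by
  let f : ℕ → Lp ℝ 2 (volume : Measure (RN N)) := fun n => (memLp_of_mem (hv n)).toLp (v n)
  have hfv : ∀ n, f n =ᵐ[volume] v n := fun n => MemLp.coeFn_toLp _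
  have hsq : ∀ n, ‖f n‖ ^ 2 = ∫ x, v n x ^ 2 := fun n => by
    rw [norm_sq_eq_integral]
    exact integral_congr_ae ((hfv n).mono fun x hx => by simp only [hx])
  have hfS : ∀ n, f n ∈ sobolevBall Ω r M := fun n =>
    ⟨mem_fracSobolevZero_congr hΩ (hfv n).symm (hv n),
      by rw [← norm_sq_eq_integral, hsq]; exact hM n,
      by rw [gagliardo_congr_ae r (hfv n)]; exact hG n⟩
  have hcomp : IsCompact (closure (sobolevBall Ω r M)) :=
    (totallyBounded_sobolevBall hΩ hΩb hr M).closure.isCompact_of_isClosed isClosed_closure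
  obtain ⟨u, -, φ₁, hφ₁, hu⟩ := hcomp.tendsto_subseq fun n => subset_closure (hfS n)
  have hmeas : TendstoInMeasure volume (fun n => (f (φ₁ n) : RN N → ℝ)) atTop u :=
    tendstoInMeasure_of_tendsto_Lp hu
  obtain ⟨φ₂, hφ₂, hae⟩ := hmeas.exists_seq_tendsto_ae
  -- The squared seminorms are merely bounded; a third extraction makes them converge, as the Fatou
  -- lemma requires.
  obtain ⟨a, -, φ₃, hφ₃, ha⟩ := (isCompact_Icc (a := (0 : ℝ)) (b := M)).tendsto_subseq
    (x := fun n => gagliardo r (v (φ₁ (φ₂ n)))) fun n => ⟨gagliardo_nonneg r _, hG _⟩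
  have hlim : ∀ᵐ x, Tendsto (fun n => v (φ₁ (φ₂ (φ₃ n))) x) atTop (𝓝 (u x)) := by
    filter_upwards [hae, ae_all_iff.mpr hfv] with x h1 h2
    have h3 := h1.comp hφ₃.tendsto_atTop
    refine h3.congr fun n => ?_
    exact h2 _
  have hu2 : MemLp u 2 volume := Lp.memLp u
  have hfatou := integrable_and_integral_le_of_tendsto
    (f := fun n z => nonlocalDiff r (v (φ₁ (φ₂ (φ₃ n)))) z ^ 2)
    (g := fun z => nonlocalDiff r u z ^ 2) (c := a)
    (fun n => (memLp_nonlocalDiff_of_mem hΩ (hv _)).integrable_sq) (fun n z => sq_nonneg _)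
    ((aestronglyMeasurable_nonlocalDiff r hu2.1).pow 2)
    (by
      filter_upwards [ae_fst hlim, ae_snd hlim] with z h1 h2
      exact ((h1.sub h2).mul_const _).pow 2) ha
  refine ⟨u, (mem_fracSobolevZero_iff hΩ r u).mpr ⟨hu2, ?_, ?_⟩, φ₁ ∘ φ₂ ∘ φ₃,
    hφ₁.comp (hφ₂.comp hφ₃), a, hlim, ?_, ha, hfatou.2⟩
  · filter_upwards [hlim, ae_all_iff.mpr fun n => ae_eq_zero_of_mem (hv n)] with x h1 h2 hx
    refine tendsto_nhds_unique h1 ?_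
    simp only [h2 _ hx, tendsto_const_nhds]
  · exact (memLp_two_iff_integrable_sq (aestronglyMeasurable_nonlocalDiff r hu2.1)).mpr hfatou.1
  · rw [← norm_sq_eq_integral]
    have h1 := (hu.comp (hφ₂.comp hφ₃).tendsto_atTop).norm.pow 2
    exact h1.congr fun n => hsq _

/-! ### The first eigenvalue -/

lemma integral_add_smul_sq {α : Type*} [MeasurableSpace α] {μ : Measure α} {f g : α → ℝ}
    (hf : MemLp f 2 μ) (hg : MemLp g 2 μ) (t : ℝ) :
    ∫ x, (f + t • g) x ^ 2 ∂μ
      = ∫ x, f x ^ 2 ∂μ + t * (2 * ∫ x, f x * g x ∂μ) + t ^ 2 * ∫ x, g x ^ 2 ∂μ := by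
  have h1 := hf.integrable_sq
  have h2 : Integrable (fun x => t * (2 * (f x * g x))) μ :=
    ((hf.integrable_mul hg).const_mul 2).const_mul t
  have h3 := hg.integrable_sq.const_mul (t ^ 2)
  have h12 : Integrable (fun x => f x ^ 2 + t * (2 * (f x * g x))) μ := h1.add h2
  rw [← integral_const_mul, ← integral_const_mul, ← integral_const_mul, ← integral_add h1 h2,
    ← integral_add h12 h3]
  refine integral_congr_ae (ae_of_all _ fun x => ?_)
  simp only [Pi.add_apply, Pi.smul_apply, smul_eq_mul]
  ring

lemma gagliardo_add_smul {Ω : Set (RN N)} (hΩ : MeasurableSet Ω) {r : ℝ} {v φ : RN N → ℝ}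
    (hv : v ∈ fracSobolevZero Ω r) (hφ : φ ∈ fracSobolevZero Ω r) (t : ℝ) :
    gagliardo r (v + t • φ) = gagliardo r v
      + t * (2 * ∫ z, nonlocalDiff r v z * nonlocalDiff r φ z) + t ^ 2 * gagliardo r φ := by
  unfold gagliardo
  rw [nonlocalDiff_add, nonlocalDiff_smul]
  exact integral_add_smul_sq (memLp_nonlocalDiff_of_mem hΩ hv) (memLp_nonlocalDiff_of_mem hΩ hφ) t

lemma integral_sq_pos {v : RN N → ℝ} (hv : MemLp v 2 volume) (h0 : ¬ (v =ᵐ[volume] 0)) :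
    0 < ∫ x, v x ^ 2 := by
  refine (integral_nonneg fun _ => sq_nonneg _).lt_of_ne' fun h => h0 ?_
  rw [integral_eq_zero_iff_of_nonneg (fun _ => sq_nonneg _) hv.integrable_sq] at h
  exact h.mono fun x hx => by simpa using hx

/-- The fractional Dirichlet Laplacian has an eigenvalue, obtained by minimizing the Rayleigh
quotient. -/
lemma exists_isFracEigenvalue [NeZero N] {Ω : Set (RN N)} (hΩo : IsOpen Ω)
    (hΩb : Bornology.IsBounded Ω) (hΩne : Ω.Nonempty) {r : ℝ} (hr0 : 0 < r) (hr1 : r < 1) :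
    ∃ lam, IsFracEigenvalue Ω r lam := by
  have hΩ := hΩo.measurableSet
  let S : Set (RN N → ℝ) := {v | v ∈ fracSobolevZero Ω r ∧ ∫ x, v x ^ 2 = 1}
  have hnormalize : ∀ v ∈ fracSobolevZero Ω r, 0 < ∫ x, v x ^ 2 →
      (√(∫ x, v x ^ 2))⁻¹ • v ∈ S := fun v hv hpos => by
    refine ⟨smul_mem_fracSobolevZero hΩ _ hv, ?_⟩
    simp only [Pi.smul_apply, smul_eq_mul, mul_pow]
    rw [integral_const_mul, inv_pow, Real.sq_sqrt hpos.le, inv_mul_cancel₀ hpos.ne']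
  have hSne : (gagliardo r '' S).Nonempty := by
    obtain ⟨v, hv, hv0⟩ := exists_mem_fracSobolevZero_ne_zero hΩo hΩb hΩne hr0 hr1
    exact ⟨_, mem_image_of_mem _ (hnormalize v hv (integral_sq_pos (memLp_of_mem hv) hv0))⟩
  have hSb : BddBelow (gagliardo r '' S) := ⟨0, by
    rintro _ ⟨v, -, rfl⟩
    exact gagliardo_nonneg r v⟩
  set m := sInf (gagliardo r '' S) with hm
  obtain ⟨e, hanti, hlim, hmem⟩ := exists_seq_tendsto_sInf hSne hSb
  choose v hvS hve using hmem
  -- The minimizing values `e` decrease, so `e 0` bounds all the squared seminorms.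
  obtain ⟨u, hu, φ, hφ, a, -, hL2, hga, hua⟩ := exists_subseq_tendsto hΩ hΩb hr0
    (M := max 1 (e 0)) (fun n => (hvS n).1) (fun n => (hvS n).2.trans_le (le_max_left _ _))
    (fun n => (hve n).trans_le ((hanti (Nat.zero_le n)).trans (le_max_right _ _)))
  have ha : a = m := by
    refine tendsto_nhds_unique hga ?_
    simp_rw [hve]
    exact hlim.comp hφ.tendsto_atTop
  have hu1 : ∫ x, u x ^ 2 = 1 := by
    refine tendsto_nhds_unique hL2 ?_
    simp_rw [(hvS _).2]
    exact tendsto_const_nhds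
  have hrayleigh : ∀ w ∈ fracSobolevZero Ω r, m * ∫ x, w x ^ 2 ≤ gagliardo r w := fun w hw => by
    rcases (integral_nonneg fun x => sq_nonneg (w x) : 0 ≤ ∫ x, w x ^ 2).eq_or_lt with h | h
    · rw [← h, mul_zero]
      exact gagliardo_nonneg r w
    · have h1 := csInf_le hSb (mem_image_of_mem _ (hnormalize w hw h))
      rw [← hm, gagliardo_smul, inv_pow, Real.sq_sqrt h.le, inv_mul_eq_div, le_div_iff₀ h] at h1
      exact h1
  have hum : gagliardo r u = m := by
    have := hrayleigh u hu
    rw [hu1] at this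
    linarith
  refine ⟨normConst N r / 2 * m, u, hu, fun h => ?_, fun ψ hψ => ?_⟩
  · have : ∫ x, u x ^ 2 = 0 := integral_eq_zero_of_ae (h.mono fun x hx => by simp [hx])
    linarith
  -- The difference `gagliardo r (u + t • ψ) - m * ∫ (u + t • ψ)²` is a nonnegative quadratic in `t`
  -- vanishing at 0. Its discriminant, the square of the linear coefficient, must be zero, which is
  -- the eigenvalue equation.
  · have hquad : ∀ t : ℝ, 0 ≤ (gagliardo r ψ - m * ∫ x, ψ x ^ 2) * (t * t)
        + (2 * (∫ z, nonlocalDiff r u z * nonlocalDiff r ψ z) - 2 * (m * ∫ x, u x * ψ x)) * t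
        + 0 := fun t => by
      have h1 := hrayleigh _
        (add_mem_fracSobolevZero hΩ hu (smul_mem_fracSobolevZero hΩ t hψ))
      rw [gagliardo_add_smul hΩ hu hψ, integral_add_smul_sq (memLp_of_mem hu) (memLp_of_mem hψ),
        hu1, hum] at h1
      linarith
    have h2 := discrim_le_zero hquad
    rw [discrim, mul_zero, sub_zero] at h2
    have h3 := pow_eq_zero_iff two_ne_zero |>.mp (le_antisymm h2 (sq_nonneg _))
    rw [fracForm_eq, mul_assoc]
    congr 1
    linarith

lemma lipschitzWith_truncation (k : ℝ) : LipschitzWith 1 fun x : ℝ => max (-k) (min x k) :=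
  (LipschitzWith.id.min_const k).const_max (-k)

/-- If `λ₁ < 1`, some function of the energy space has Dirichlet form smaller than its squared
`L²` norm. -/
lemma exists_mem_energySpace_gagliardo_lt [NeZero N] {Ω : Set (RN N)} (hΩo : IsOpen Ω)
    (hΩb : Bornology.IsBounded Ω) (hΩne : Ω.Nonempty) {r : ℝ} (hr0 : 0 < r) (hr1 : r < 1)
    (p : ℝ) (hlam : firstEigenvalue Ω r < 1) :
    ∃ w ∈ energySpace Ω r p, normConst N r / 2 * gagliardo r w < ∫ x, w x ^ 2 := by
  have hΩ := hΩo.measurableSet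
  -- The `sInf` of the empty set is 0, which is below 1; the existence of an eigenvalue is therefore
  -- needed to extract one below 1.
  obtain ⟨lam, ⟨v, hv, hv0, heq⟩, hlt⟩ :=
    exists_lt_of_csInf_lt (exists_isFracEigenvalue hΩo hΩb hΩne hr0 hr1) hlam
  have hpos := integral_sq_pos (memLp_of_mem hv) hv0
  have hvv : normConst N r / 2 * gagliardo r v < ∫ x, v x ^ 2 := by
    rw [← fracForm_self, heq v hv]
    simp only [← sq]
    nlinarith
  -- The eigenfunction need not be in `L^p`. Its truncations are bounded with support in `Ω`, do not
  -- increase the seminorm, and recover the `L²` norm as `k → ∞`, so the strict inequality survives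
  -- for some `k`.
  let T : ℕ → ℝ → ℝ := fun k x => max (-(k : ℝ)) (min x k)
  have hT : ∀ k, LipschitzWith 1 (T k) := fun k => lipschitzWith_truncation k
  have hT0 : ∀ k, T k 0 = 0 := fun k => by simp [T]
  have hTle : ∀ k x, |T k x| ≤ |x| := fun k x => by
    simpa [hT0 k] using (hT k).dist_le_mul x 0
  have hTk : ∀ k x, |T k x| ≤ k := fun k x =>
    abs_le.mpr ⟨le_max_left _ _, max_le (by linarith [(Nat.cast_nonneg k : (0 : ℝ) ≤ k)])
      (min_le_right _ _)⟩
  have hlim : Tendsto (fun k => ∫ x, (T k ∘ v) x ^ 2) atTop (𝓝 (∫ x, v x ^ 2)) := by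
    refine tendsto_integral_of_dominated_convergence (fun x => v x ^ 2)
      (fun k => (((hT k).continuous.comp_aestronglyMeasurable (memLp_of_mem hv).1).pow 2))
      (memLp_of_mem hv).integrable_sq (fun k => ae_of_all _ fun x => ?_)
      (ae_of_all _ fun x => ?_)
    · rw [Real.norm_of_nonneg (sq_nonneg _)]
      exact sq_le_sq.mpr (hTle k _)
    · refine tendsto_const_nhds.congr' ?_
      obtain ⟨n, hn⟩ := exists_nat_ge |v x|
      filter_upwards [eventually_ge_atTop n] with k hk
      have h1 : |v x| ≤ k := hn.trans (by exact_mod_cast hk)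
      have h2 := abs_le.mp h1
      simp only [Function.comp, T, min_eq_left h2.2, max_eq_right h2.1]
  obtain ⟨k, hk⟩ := (hlim.eventually_const_lt hvv).exists
  have hmem := comp_mem_fracSobolevZero hΩ (hT k) (hT0 k) hv
  refine ⟨T k ∘ v, ⟨hmem, ?_⟩, lt_of_le_of_lt ?_ hk⟩
  · refine (memLp_indicator_const _ hΩ (k : ℝ) (Or.inr hΩb.measure_lt_top.ne)).of_le
      (memLp_of_mem hmem).1 ?_
    filter_upwards [ae_eq_zero_of_mem hmem] with x hx
    by_cases hxΩ : x ∈ Ω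
    · simpa [hxΩ] using hTk k (v x)
    · rw [hx hxΩ]
      simp
  · exact mul_le_mul_of_nonneg_left (gagliardo_comp_le hΩ (hT k) (hT0 k) hv)
      (by linarith [normConst_pos (N := N) hr0 hr1])

/-! ### The nonlinearity -/

lemma betaHat_nonneg {p : ℝ} (hp : 0 < p) (t : ℝ) : 0 ≤ betaHat p t :=
  mul_nonneg (by positivity) (Real.rpow_nonneg (abs_nonneg t) p)

lemma continuous_betaHat {p : ℝ} (hp : 0 < p) : Continuous (betaHat p) :=
  continuous_const.mul (continuous_abs.rpow_const fun _ => Or.inr hp.le)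

lemma beta_eq (p t : ℝ) : beta p t = |t| ^ (p - 2) * t := by
  rcases eq_or_ne t 0 with rfl | ht
  · simp [beta]
  · have h : |t| ^ (p - 1) = |t| ^ (p - 2) * |t| := by
      rw [← Real.rpow_add_one (abs_pos.mpr ht).ne']
      congr 1
      ring
    have hs : |t| * Real.sign t = t := by
      rcases ht.lt_or_gt with h | h
      · rw [Real.sign_of_neg h, abs_of_neg h]
        ring
      · rw [Real.sign_of_pos h, abs_of_pos h, mul_one]
    rw [beta, h, mul_assoc, hs]

lemma continuous_beta {p : ℝ} (hp : 2 < p) : Continuous (beta p) := by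
  have : beta p = fun t => |t| ^ (p - 2) * t := funext (beta_eq p)
  rw [this]
  exact (continuous_abs.rpow_const fun _ => Or.inr (by linarith)).mul continuous_id

lemma hasDerivAt_betaHat {p : ℝ} (hp : 2 < p) (t : ℝ) : HasDerivAt (betaHat p) (beta p t) t := by
  have h := (hasDerivAt_abs_rpow t (by linarith : 1 < p)).const_mul (1 / p)
  refine h.congr_deriv ?_
  have hp0 : p ≠ 0 := by linarith
  rw [beta_eq, mul_assoc, one_div, inv_mul_cancel_left₀ hp0]

lemma abs_beta_le {p : ℝ} (t : ℝ) : |beta p t| ≤ |t| ^ (p - 1) := by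
  rw [beta, abs_mul, abs_of_nonneg (Real.rpow_nonneg (abs_nonneg t) _)]
  refine mul_le_of_le_one_right (Real.rpow_nonneg (abs_nonneg t) _) ?_
  rcases Real.sign_apply_eq t with h | h | h <;> simp [h]

lemma exists_sq_sub_le_betaHat {p : ℝ} (hp : 2 < p) :
    ∃ K : ℝ, 0 ≤ K ∧ ∀ t : ℝ, t ^ 2 - K ≤ betaHat p t := by
  have hp0 : 0 < p := by linarith
  -- Above the threshold `p ^ (1 / (p - 2))` one has `|t| ^ (p - 2) ≥ p`, hence `betaHat p t ≥ t ^
  -- 2`; below it the constant absorbs `t ^ 2`.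
  refine ⟨(p ^ (1 / (p - 2))) ^ 2, sq_nonneg _, fun t => ?_⟩
  have hP : 0 ≤ p ^ (1 / (p - 2)) := Real.rpow_nonneg hp0.le _
  rcases le_or_gt |t| (p ^ (1 / (p - 2))) with h | h
  · have h1 : t ^ 2 ≤ (p ^ (1 / (p - 2))) ^ 2 := by
      rw [← sq_abs]
      exact pow_le_pow_left₀ (abs_nonneg t) h 2
    linarith [betaHat_nonneg hp0 t]
  · have ht : 0 < |t| := hP.trans_lt h
    have h1 : p ≤ |t| ^ (p - 2) := by
      have := Real.rpow_le_rpow hP h.le (by linarith : 0 ≤ p - 2)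
      rwa [← Real.rpow_mul hp0.le, one_div_mul_cancel (by linarith), Real.rpow_one] at this
    have h2 : |t| ^ p = |t| ^ (p - 2) * t ^ 2 := by
      rw [← sq_abs t, ← Real.rpow_natCast |t| 2, ← Real.rpow_add ht]
      congr 1
      push_cast
      ring
    have h3 : t ^ 2 ≤ betaHat p t := by
      rw [betaHat, h2, ← mul_assoc, one_div_mul_eq_div]
      exact le_mul_of_one_le_left (sq_nonneg t) ((one_le_div hp0).mpr h1)
    linarith [sq_nonneg (p ^ (1 / (p - 2)))]

/-! ### The energy: coercivity, minimizers, Euler–Lagrange equation, negative values. -/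

section Energy

variable {Ω : Set (RN N)} {σ p : ℝ} {u v w φ : RN N → ℝ}

lemma add_smul_mem_energySpace (hΩ : MeasurableSet Ω) (hv : v ∈ energySpace Ω σ p)
    (hw : w ∈ energySpace Ω σ p) (t : ℝ) : v + t • w ∈ energySpace Ω σ p :=
  ⟨add_mem_fracSobolevZero hΩ hv.1 (smul_mem_fracSobolevZero hΩ t hw.1),
    hv.2.add (hw.2.const_smul t)⟩

lemma smul_mem_energySpace (hΩ : MeasurableSet Ω) (hw : w ∈ energySpace Ω σ p) (t : ℝ) :
    t • w ∈ energySpace Ω σ p :=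
  ⟨smul_mem_fracSobolevZero hΩ t hw.1, hw.2.const_smul t⟩

lemma setIntegral_sq_eq (hv : v ∈ fracSobolevZero Ω σ) : ∫ x in Ω, v x ^ 2 = ∫ x, v x ^ 2 := by
  refine setIntegral_eq_integral_of_ae_compl_eq_zero ?_
  filter_upwards [ae_eq_zero_of_mem hv] with x hx hx'
  rw [hx hx']
  norm_num

lemma energy_eq_setIntegral [NeZero N] (Ω : Set (RN N)) (σ p : ℝ) (v : RN N → ℝ) :
    energy Ω σ p v = normConst N σ / 4 * gagliardo σ v + (∫ x in Ω, betaHat p (v x))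
      - 1 / 2 * ∫ x in Ω, v x ^ 2 := by
  simp only [energy, gagliardo, sq_abs, div_norm_rpow_eq_mul_kernel, nonlocalDiff_sq,
    mul_comm (kernel σ _)]

lemma energy_eq [NeZero N] (p : ℝ) (hv : v ∈ fracSobolevZero Ω σ) :
    energy Ω σ p v = normConst N σ / 4 * gagliardo σ v + (∫ x in Ω, betaHat p (v x))
      - 1 / 2 * ∫ x, v x ^ 2 := by
  rw [energy_eq_setIntegral, setIntegral_sq_eq hv]

lemma integrable_abs_rpow {α : Type*} [MeasurableSpace α] {μ : Measure α} {f : α → ℝ}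
    (hp : 0 < p) (hf : MemLp f (ENNReal.ofReal p) μ) : Integrable (fun x => |f x| ^ p) μ := by
  have h := hf.integrable_norm_rpow (by simpa using hp) ENNReal.ofReal_ne_top
  simpa only [ENNReal.toReal_ofReal hp.le, Real.norm_eq_abs] using h

lemma integrable_betaHat (hp : 0 < p) (hv : MemLp v (ENNReal.ofReal p) volume) :
    Integrable (fun x => betaHat p (v x)) :=
  (integrable_abs_rpow hp hv).const_mul _

/-- Coercivity of the energy. -/
lemma exists_energy_ge [NeZero N] (hΩb : Bornology.IsBounded Ω) (σ : ℝ)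
    (hp : 2 < p) : ∃ K : ℝ, ∀ v ∈ energySpace Ω σ p,
      normConst N σ / 4 * gagliardo σ v + 1 / 2 * (∫ x, v x ^ 2) - K ≤ energy Ω σ p v := by
  obtain ⟨K, hK0, hK⟩ := exists_sq_sub_le_betaHat hp
  refine ⟨volume.real Ω * K, fun v hv => ?_⟩
  rw [energy_eq p hv.1]
  have hsq := (memLp_of_mem hv.1).integrable_sq.restrict (s := Ω)
  have hc : IntegrableOn (fun _ : RN N => K) Ω := integrableOn_const hΩb.measure_lt_top.ne
  -- Half of this `∫ v²` compensates the negative term of the energy; the other half remains.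
  have h1 : ∫ x in Ω, (v x ^ 2 - K) ≤ ∫ x in Ω, betaHat p (v x) :=
    integral_mono (hsq.sub hc) (integrable_betaHat (by linarith) hv.2).restrict fun x => hK (v x)
  rw [integral_sub hsq hc, setIntegral_sq_eq hv.1, setIntegral_const, smul_eq_mul] at h1
  linarith

/-- The direct method: the energy attains its infimum. -/
lemma exists_isMinOn_energy [NeZero N] (hΩo : IsOpen Ω) (hΩb : Bornology.IsBounded Ω)
    (hσ0 : 0 < σ) (hσ1 : σ < 1) (hp : 2 < p) (hne : (energySpace Ω σ p).Nonempty) :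
    ∃ u ∈ energySpace Ω σ p, IsMinOn (energy Ω σ p) (energySpace Ω σ p) u := by
  have hΩ := hΩo.measurableSet
  have hp0 : 0 < p := by linarith
  have hC := normConst_pos (N := N) hσ0 hσ1
  obtain ⟨K, hK⟩ := exists_energy_ge hΩb σ hp
  have hsq0 : ∀ v : RN N → ℝ, 0 ≤ ∫ x, v x ^ 2 := fun v => integral_nonneg fun _ => sq_nonneg _
  have hbdd : BddBelow (energy Ω σ p '' energySpace Ω σ p) := ⟨-K, by
    rintro _ ⟨v, hv, rfl⟩
    have h1 := hK v hv
    have h2 := mul_nonneg (by linarith : 0 ≤ normConst N σ / 4) (gagliardo_nonneg σ v)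
    linarith [hsq0 v]⟩
  obtain ⟨e, hanti, hlim, hmem⟩ := exists_seq_tendsto_sInf (hne.image (energy Ω σ p)) hbdd
  set m := sInf (energy Ω σ p '' energySpace Ω σ p) with hm
  choose v hv hve using hmem
  have hbound : ∀ n, normConst N σ / 4 * gagliardo σ (v n) + 1 / 2 * (∫ x, v n x ^ 2)
      ≤ e 0 + K := fun n => by
    linarith [hK _ (hv n), (hve n).le, hanti (Nat.zero_le n)]
  -- Both terms on the left of `hbound` are nonnegative, so each is bounded separately; `M` is the
  -- larger of the two bounds.
  obtain ⟨u, hu, ψ, hψ, a, hae, hL2, hga, hua⟩ := exists_subseq_tendsto hΩ hΩb hσ0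
    (M := max (2 * (e 0 + K)) ((e 0 + K) / (normConst N σ / 4))) (fun n => (hv n).1)
    (fun n => le_max_of_le_left (by
      have h2 := mul_nonneg (by linarith : 0 ≤ normConst N σ / 4) (gagliardo_nonneg σ (v n))
      linarith [hbound n]))
    (fun n => le_max_of_le_right (by
      rw [le_div_iff₀ (by linarith)]
      linarith [hbound n, hsq0 (v n)]))
  -- The energies, seminorms and `L²` norms all converge, which forces the limit of the remaining
  -- term.
  have hB : Tendsto (fun n => ∫ x in Ω, betaHat p (v (ψ n) x)) atTop
      (𝓝 (m - normConst N σ / 4 * a + 1 / 2 * ∫ x, u x ^ 2)) := by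
    refine (((hlim.comp hψ.tendsto_atTop).sub (hga.const_mul (normConst N σ / 4))).add
      (hL2.const_mul (1 / 2))).congr fun n => ?_
    simp only [Function.comp, ← hve, energy_eq p (hv _).1]
    ring
  have hfatou := integrable_and_integral_le_of_tendsto (μ := volume.restrict Ω)
    (f := fun n x => betaHat p (v (ψ n) x)) (g := fun x => betaHat p (u x))
    (fun n => (integrable_betaHat hp0 (hv _).2).restrict) (fun n x => betaHat_nonneg hp0 _)
    ((continuous_betaHat hp0).comp_aestronglyMeasurable (memLp_of_mem hu).1.restrict)
    (ae_restrict_of_ae (hae.mono fun x hx => ((continuous_betaHat hp0).tendsto _).comp hx)) hB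
  -- Fatou makes `betaHat p ∘ u` integrable on `Ω`, which is the `L^p` bound there; outside `Ω` the
  -- function is zero a.e.
  have huE : u ∈ energySpace Ω σ p := by
    refine ⟨hu, ?_⟩
    have h1 : MemLp u (ENNReal.ofReal p) (volume.restrict Ω) := by
      refine (integrable_norm_rpow_iff (memLp_of_mem hu).1.restrict
        (by simpa using hp0) ENNReal.ofReal_ne_top).mp ?_
      simp only [ENNReal.toReal_ofReal hp0.le, Real.norm_eq_abs]
      refine (hfatou.1.const_mul p).congr (ae_of_all _ fun x => ?_)
      simp only [betaHat]
      field_simp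
    refine (memLp_congr_ae ?_).mp ((memLp_indicator_iff_restrict hΩ).mpr h1)
    filter_upwards [ae_eq_zero_of_mem hu] with x hx
    by_cases hxΩ : x ∈ Ω
    · simp [hxΩ]
    · simp [hxΩ, hx hxΩ]
  refine ⟨u, huE, fun w hw => ?_⟩
  have h1 : energy Ω σ p u ≤ m := by
    rw [energy_eq p hu]
    linarith [hfatou.2, mul_le_mul_of_nonneg_left hua (by linarith : 0 ≤ normConst N σ / 4)]
  exact h1.trans (csInf_le hbdd (mem_image_of_mem _ hw))

/-- Differentiation under the integral: for `|t| < 1` the derivative is at most `(|u| + |φ|) ^ (p -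
1) * |φ| ≤ (|u| + |φ|) ^ p`, integrable because both functions are in `L^p`. -/
lemma hasDerivAt_setIntegral_betaHat (hp : 2 < p) (hu : MemLp u (ENNReal.ofReal p) volume)
    (hφ : MemLp φ (ENNReal.ofReal p) volume) (Ω : Set (RN N)) :
    HasDerivAt (fun t : ℝ => ∫ x in Ω, betaHat p ((u + t • φ) x))
      (∫ x in Ω, beta p (u x) * φ x) 0 := by
  have hp0 : 0 < p := by linarith
  have hbound : Integrable (fun x => (|u x| + |φ x|) ^ p) (volume.restrict Ω) := by
    have := (integrable_abs_rpow hp0 (hu.abs.add hφ.abs)).restrict (s := Ω)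
    refine this.congr (ae_of_all _ fun x => ?_)
    simp only [Pi.add_apply, Pi.abs_apply]
    rw [abs_of_nonneg (add_nonneg (abs_nonneg _) (abs_nonneg _))]
  have h := hasDerivAt_integral_of_dominated_loc_of_deriv_le (μ := volume.restrict Ω)
    (F := fun (t : ℝ) x => betaHat p ((u + t • φ) x)) (x₀ := 0) (s := Metric.ball 0 1)
    (F' := fun t x => beta p ((u + t • φ) x) * φ x) (bound := fun x => (|u x| + |φ x|) ^ p)
    (Metric.ball_mem_nhds 0 one_pos)
    (Eventually.of_forall fun t => (continuous_betaHat hp0).comp_aestronglyMeasurable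
      (hu.add (hφ.const_smul t)).1.restrict)
    (integrable_betaHat hp0 (hu.add (hφ.const_smul (0 : ℝ)))).restrict
    (((continuous_beta hp).comp_aestronglyMeasurable
      (hu.add (hφ.const_smul (0 : ℝ))).1.restrict).mul hφ.1.restrict)
    (ae_of_all _ fun x t ht => ?_) hbound (ae_of_all _ fun x t _ => ?_)
  · simpa using h.2
  · have ht1 : |t| ≤ 1 := by simpa using (mem_ball_zero_iff.mp ht).le
    have h1 : |(u + t • φ) x| ≤ |u x| + |φ x| := by
      refine (abs_add_le _ _).trans (add_le_add_right ?_ _)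
      simp only [Pi.smul_apply, smul_eq_mul, abs_mul]
      exact mul_le_of_le_one_left (abs_nonneg _) ht1
    have h0 : 0 ≤ |u x| + |φ x| := by positivity
    rw [norm_mul, Real.norm_eq_abs, Real.norm_eq_abs]
    calc |beta p ((u + t • φ) x)| * |φ x|
        ≤ (|u x| + |φ x|) ^ (p - 1) * (|u x| + |φ x|) :=
          mul_le_mul ((abs_beta_le _).trans
            (Real.rpow_le_rpow (abs_nonneg _) h1 (by linarith)))
            (le_add_of_nonneg_left (abs_nonneg _)) (abs_nonneg _) (Real.rpow_nonneg h0 _)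
      _ = (|u x| + |φ x|) ^ p := by
          rw [← Real.rpow_add_one' h0 (by linarith), sub_add_cancel]
  · have h1 : HasDerivAt (fun t : ℝ => (u + t • φ) x) (φ x) t := by
      simpa using ((hasDerivAt_id t).mul_const (φ x)).const_add (u x)
    exact (hasDerivAt_betaHat hp _).comp t h1

/-- The Euler-Lagrange equation. -/
lemma isWeakSolution_of_isMinOn [NeZero N] (hΩo : IsOpen Ω) (hp : 2 < p)
    (hu : u ∈ energySpace Ω σ p) (hmin : IsMinOn (energy Ω σ p) (energySpace Ω σ p) u) :
    IsWeakSolution Ω σ p u := by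
  have hΩ := hΩo.measurableSet
  refine ⟨hu, fun φ hφ => ?_⟩
  have hquad : ∀ a b c : ℝ, HasDerivAt (fun t : ℝ => a + t * b + t ^ 2 * c) b 0 := fun a b c => by
    have := (((hasDerivAt_id (0 : ℝ)).mul_const b).const_add a).add
      (((hasDerivAt_id (0 : ℝ)).pow 2).mul_const c)
    exact this.congr_deriv (by simp)
  -- Along `u + t • φ` the seminorm and `L²` terms are quadratic polynomials in `t`; only the
  -- `betaHat` term needs dominated convergence.
  have h := (((hquad (gagliardo σ u)
      (2 * ∫ z, nonlocalDiff σ u z * nonlocalDiff σ φ z)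
      (gagliardo σ φ)).const_mul (normConst N σ / 4)).add
    (hasDerivAt_setIntegral_betaHat hp hu.2 hφ.2 Ω)).sub
    ((hquad (∫ x in Ω, u x ^ 2) (2 * ∫ x in Ω, u x * φ x)
      (∫ x in Ω, φ x ^ 2)).const_mul (1 / 2))
  have hE := h.congr_of_eventuallyEq (f₁ := fun t : ℝ => energy Ω σ p (u + t • φ)) (by
    refine Eventually.of_forall fun t => ?_
    simp only [energy_eq_setIntegral, gagliardo_add_smul hΩ hu.1 hφ.1,
      integral_add_smul_sq ((memLp_of_mem hu.1).restrict Ω) ((memLp_of_mem hφ.1).restrict Ω)]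
    rfl)
  have hloc : IsLocalMin (fun t : ℝ => energy Ω σ p (u + t • φ)) 0 := by
    refine Eventually.of_forall fun t => ?_
    simp only [zero_smul, add_zero]
    exact hmin (add_smul_mem_energySpace hΩ hu hφ t)
  have h0 := hloc.hasDerivAt_eq_zero hE
  rw [fracForm_eq]
  linarith

/-- The energy of `t • w` is `t ^ 2 * (A + t ^ (p - 2) * B)` with `A < 0`; as `p > 2`, the bracket
tends to `A` when `t → 0⁺`. -/
lemma exists_energy_neg [NeZero N] (hΩo : IsOpen Ω) (hp : 2 < p) (hw : w ∈ energySpace Ω σ p)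
    (hlt : normConst N σ / 2 * gagliardo σ w < ∫ x, w x ^ 2) :
    ∃ v ∈ energySpace Ω σ p, energy Ω σ p v < 0 := by
  have hΩ := hΩo.measurableSet
  set A := normConst N σ / 4 * gagliardo σ w - 1 / 2 * ∫ x, w x ^ 2 with hA
  set B := ∫ x in Ω, betaHat p (w x) with hB
  have hA0 : A < 0 := by linarith
  have hlim : Tendsto (fun t : ℝ => A + t ^ (p - 2) * B) (𝓝[>] 0) (𝓝 A) := by
    have h1 := (Real.continuousAt_rpow_const 0 (p - 2) (Or.inr (by linarith))).tendsto
    rw [Real.zero_rpow (by linarith)] at h1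
    simpa using ((h1.mono_left nhdsWithin_le_nhds).mul_const B).const_add A
  obtain ⟨t, ht, ht0⟩ := ((hlim.eventually_lt_const hA0).and eventually_mem_nhdsWithin).exists
  have ht0 : 0 < t := ht0
  refine ⟨t • w, smul_mem_energySpace hΩ hw t, ?_⟩
  have h1 : ∫ x in Ω, betaHat p ((t • w) x) = t ^ 2 * (t ^ (p - 2) * B) := by
    have h2 : ∀ x, betaHat p ((t • w) x) = t ^ p * betaHat p (w x) := fun x => by
      simp only [betaHat, Pi.smul_apply, smul_eq_mul, abs_mul, abs_of_pos ht0,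
        Real.mul_rpow ht0.le (abs_nonneg _)]
      ring
    have h3 : t ^ p = t ^ 2 * t ^ (p - 2) := by
      rw [← Real.rpow_natCast t 2, ← Real.rpow_add ht0]
      congr 1
      push_cast
      ring
    simp_rw [h2]
    rw [integral_const_mul, h3, mul_assoc]
  have h4 : ∫ x, (t • w) x ^ 2 = t ^ 2 * ∫ x, w x ^ 2 := by
    simp only [Pi.smul_apply, smul_eq_mul, mul_pow]
    exact integral_const_mul _ _
  rw [energy_eq p (smul_mem_energySpace hΩ hw t).1, h1, h4, gagliardo_smul]
  have h5 := mul_neg_of_pos_of_neg (pow_pos ht0 2) ht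
  rw [hA] at h5
  linarith

end Energy

end FracDirichlet

end

/-! ### Assembly of the main theorem. -/

theorem mainTheorem6 (N : ℕ) [NeZero N] (Ω : Set (RN N)) (hΩo : IsOpen Ω)
    (hΩb : Bornology.IsBounded Ω) (hΩne : Ω.Nonempty)
    (σ : ℝ) (hσ0 : 0 < σ) (hσ1 : σ < 1) (p : ℝ) (hp : 2 < p)
    (hlam : firstEigenvalue Ω σ < 1) :
    sInf (energy Ω σ p '' energySpace Ω σ p) < 0 ∧
      ∃ u : RN N → ℝ, u ∈ energySpace Ω σ p ∧
        IsMinOn (energy Ω σ p) (energySpace Ω σ p) u ∧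
        IsWeakSolution Ω σ p u ∧ ¬ (u =ᵐ[volume] 0) := by
  obtain ⟨w, hw, hlt⟩ := exists_mem_energySpace_gagliardo_lt hΩo hΩb hΩne hσ0 hσ1 p hlam
  obtain ⟨v, hv, hneg⟩ := exists_energy_neg hΩo hp hw hlt
  obtain ⟨u, hu, hmin⟩ := exists_isMinOn_energy hΩo hΩb hσ0 hσ1 hp ⟨w, hw⟩
  have hule : ∀ x ∈ energySpace Ω σ p, energy Ω σ p u ≤ energy Ω σ p x := fun x hx => hmin hx
  have hbdd : BddBelow (energy Ω σ p '' energySpace Ω σ p) :=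
    ⟨energy Ω σ p u, by
      rintro _ ⟨x, hx, rfl⟩
      exact hule x hx⟩
  refine ⟨csInf_lt_of_lt hbdd (mem_image_of_mem _ hv) hneg, u, hu, hmin,
    isWeakSolution_of_isMinOn hΩo hp hu hmin, fun h0 => ?_⟩
  -- If `u` vanished a.e., the only negative term of its energy would be zero, contradicting the
  -- negative minimum.
  have h1 : ∫ x, u x ^ 2 = 0 :=
    integral_eq_zero_of_ae (h0.mono fun x hx => by simp [hx])
  have h2 := (hule v hv).trans_lt hneg
  rw [energy_eq p hu.1, h1] at h2
  have h3 : 0 ≤ normConst N σ / 4 * gagliardo σ u :=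
    mul_nonneg (by linarith [normConst_pos (N := N) hσ0 hσ1]) (gagliardo_nonneg σ u)
  have h4 : 0 ≤ ∫ x in Ω, betaHat p (u x) :=
    integral_nonneg fun x => betaHat_nonneg (by linarith) _
  linarith
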